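/- Let $J>0$ and $h\in\mathbb R$. For integers $m<n$ let $\mu^{m,n}_{J,h}$ be the probability measure on $\{-1,1\}^{E_{m,n}}$, $E_{m,n}=\{e_{m,m+1},\dots,e_{n-1,n}\}$, whose weights are proportional to $$\exp\Big(J\sum_{i=m}^{n-2}x(e_{i,i+1})x(e_{i+1,i+2})+h\sum_{i=m}^{n-1}x(e_{i,i+1})\Big).$$ Then the limit in distribution $\mu^{\mathbb Z}_{J,h}=\lim_{m\to-\infty,\,n\to\infty}\mu^{m,n}_{J,h}$ on $\{-1,1\}^{\{e_{i,i+1}:\,i\in\mathbb Z\}}$ (the Ising model on the edges of $\mathbb Z$ with constant field $h$) exists. Let $Y$ have law $\mu^{\mathbb Z}_{J,h}$, and let $\pi_Y$ be the random equivalence relation on $\mathbb Z$ in which $k<l$ are equivalent if and only if $Y(e_{k,k+1})=\dots=Y(e_{l-1,l})=1$. For $p\in[0,1]$ let $X^{Y,p}$ be the associated color process: given $\pi_Y$, independently for different equivalence classes, all elements of a class receive the value $1$ with probability $p$ and the value $0$ with probability $1-p$. Call a $\{0,1\}$-valued process $(X(k))_{k\in\mathbb Z}$ $n$-step Markov if for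 all $k\in\mathbb Z$, all $m\ge n$ and all values $a_{k-m},\dots,a_k\in\{0,1\}$, $$\mathbf P(X(k)=a_k\mid X(k-m)=a_{k-m},\dots,X(k-1)=a_{k-1})=\mathbf P(X(k)=a_k\mid X(k-n)=a_{k-n},\dots,X(k-1)=a_{k-1})$$ whenever the first conditioning event has positive probability. Then for every $p\in[0,1]$ and every integer $n\ge1$, the process $X^{Y,p}$ is $n$-step Markov if and only if $p\in\{0,1\}$. In particular, for $p\in(0,1)$ it is not $n$-step Markov for any $n\ge1$. -/

import Mathlib

open MeasureTheory ProbabilityTheory Filter Topology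

namespace DivideColor

/-! ### Random equivalence relations and color processes on a countable set

A partition of `V` is a `Setoid V`; a random equivalence relation is a probability measure
on `Setoid V`; colors are booleans, `true` standing for `1` and `false` for `0`. -/

/-- The σ-algebra on partitions of `V` generated by the restrictions to finite subsets of `V`,
i.e. by the events "`u` and `v` are in the same class". -/
instance instMeasurableSpaceSetoid (V : Type*) : MeasurableSpace (Setoid V) :=
  MeasurableSpace.generateFrom (Set.range fun uv : V × V => {r : Setoid V | r uv.1 uv.2})

/-- Given a partition `r`, color its classes independently, `1` with probability `p` and `0` with
probability `1 - p`, and give every vertex the color of its class: the law of the result. -/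
noncomputable def colorGiven {V : Type*} (p : unitInterval) (r : Setoid V) :
    Measure (V → Bool) :=
  (Measure.infinitePi fun _ : Quotient r => bernoulliMeasure true false p).map
    fun c v => c (Quotient.mk r v)

theorem measurableSet_rel {V : Type*} (u v : V) : MeasurableSet {r : Setoid V | r u v} :=
  MeasurableSpace.measurableSet_generateFrom ⟨(u, v), rfl⟩

instance {V : Type*} (p : unitInterval) (r : Setoid V) :
    IsProbabilityMeasure (colorGiven p r) :=
  Measure.isProbabilityMeasure_map
    (measurable_pi_lambda _ fun v => measurable_pi_apply (Quotient.mk r v)).aemeasurable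

/-- The color law depends measurably on the partition. -/
theorem measurable_colorGiven {V : Type*} [Countable V] (p : unitInterval) :
    Measurable (colorGiven p : Setoid V → Measure (V → Bool)) := by
  classical
  obtain ⟨e, he⟩ := Countable.exists_injective_nat V
  have hex : ∀ (r : Setoid V) (v : V), ∃ k, ∃ w, r v w ∧ e w = k :=
    fun r v => ⟨e v, v, r.refl v, rfl⟩
  let rep : Setoid V → V → V := fun r v => (Nat.find_spec (hex r v)).choose
  have rep_rel : ∀ (r : Setoid V) v, r v (rep r v) := fun r v => (Nat.find_spec (hex r v)).choose_spec.1
  have rep_e : ∀ r v, e (rep r v) = Nat.find (hex r v) :=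
    fun r v => (Nat.find_spec (hex r v)).choose_spec.2
  have rep_min : ∀ (r : Setoid V) v w, r v w → e (rep r v) ≤ e w := by
    intro r v w h
    rw [rep_e]
    exact Nat.find_min' (hex r v) ⟨w, h, rfl⟩
  have rep_eq : ∀ (r : Setoid V) v w, rep r v = w ↔ r v w ∧ ∀ u, r v u → e w ≤ e u := by
    intro r v w
    refine ⟨fun h => h ▸ ⟨rep_rel r v, rep_min r v⟩, fun h => he (le_antisymm ?_ ?_)⟩
    · exact rep_min r v w h.1
    · exact h.2 _ (rep_rel r v)
  have rep_congr : ∀ (r : Setoid V) v w, r v w → rep r v = rep r w := by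
    intro r v w h
    rw [rep_eq]
    exact ⟨r.trans h (rep_rel r w), fun u hu => rep_min r w u (r.trans (r.symm h) hu)⟩
  have rep_meas : ∀ v w, MeasurableSet {r : Setoid V | rep r v = w} := by
    intro v w
    have : {r : Setoid V | rep r v = w}
        = {r : Setoid V | r v w} ∩ ⋂ u, ({r : Setoid V | r v u}ᶜ ∪ {_r : Setoid V | e w ≤ e u}) := by
      ext r
      simp only [Set.mem_ofPred_eq, rep_eq, Set.mem_inter_iff, Set.mem_iInter, Set.mem_union,
        Set.mem_compl_iff, imp_iff_not_or]
    rw [this]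
    exact (measurableSet_rel v w).inter
      (MeasurableSet.iInter fun u => (measurableSet_rel v u).compl.union (MeasurableSet.const _))
  let Q : Measure (V → Bool) := Measure.infinitePi fun _ : V => bernoulliMeasure true false p
  let f : Setoid V × (V → Bool) → V → Bool := fun rx v => rx.2 (rep rx.1 v)
  have f_meas : Measurable f := by
    refine measurable_pi_iff.2 fun v => measurable_to_countable' fun b => ?_
    have : (fun rx => f rx v) ⁻¹' {b}
        = ⋃ w, {r : Setoid V | rep r v = w} ×ˢ {x : V → Bool | x w = b} := by
      ext rx
      simp [f]
    rw [this]
    exact MeasurableSet.iUnion fun w => (rep_meas v w).prod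
      (measurableSet_eq_fun (measurable_pi_apply w) measurable_const)
  have key : ∀ r : Setoid V, colorGiven p r = Q.map (fun x => f (r, x)) := by
    intro r
    let ρ : Quotient r → V := Quotient.lift (rep r) (fun a b h => rep_congr r a b h)
    have hρ : Function.Injective ρ := by
      intro a b
      induction a using Quotient.inductionOn
      induction b using Quotient.inductionOn
      rename_i a b
      intro h
      have h' : rep r a = rep r b := h
      exact Quotient.sound (r.trans (rep_rel r a) (r.symm (h'.symm ▸ rep_rel r b)))
    have h1 : Q.map (fun x (q : Quotient r) => x (ρ q))
        = Measure.infinitePi fun _ : Quotient r => bernoulliMeasure true false p := by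
      have hi : iIndepFun (fun (v : V) (x : V → Bool) => x v) Q :=
        iIndepFun_infinitePi (P := fun _ : V => bernoulliMeasure true false p)
          (X := fun _ b => b) (fun _ => measurable_id)
      have h2 := (iIndepFun_iff_map_fun_eq_infinitePi_map (by fun_prop)).1 (hi.precomp hρ)
      have h3 : ∀ v : V, Q.map (fun x => x v) = bernoulliMeasure true false p :=
        fun v => Measure.infinitePi_map_eval _ v
      simpa only [Function.comp_def, h3] using h2
    have m1 : Measurable fun (c : Quotient r → Bool) (v : V) => c (Quotient.mk r v) :=
      measurable_pi_lambda _ fun v => measurable_pi_apply (Quotient.mk r v)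
    have m2 : Measurable fun (x : V → Bool) (q : Quotient r) => x (ρ q) :=
      measurable_pi_lambda _ fun q => measurable_pi_apply (ρ q)
    rw [colorGiven, ← h1]
    exact (Measure.map_map m1 m2).trans rfl
  refine Measure.measurable_of_measurable_coe _ fun s hs => ?_
  have : (fun r : Setoid V => colorGiven p r s)
      = fun r => Q (Prod.mk r ⁻¹' (f ⁻¹' s)) := by
    funext r
    have hf : Measurable fun x => f (r, x) := f_meas.comp measurable_prodMk_left
    rw [key, Measure.map_apply hf hs]
    rfl
  rw [this]
  exact measurable_measure_prodMk_left (f_meas hs)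

/-- `colorGiven` as a Markov kernel from partitions to colorings. -/
noncomputable def colorKernel (V : Type*) [Countable V] (p : unitInterval) :
    Kernel (Setoid V) (V → Bool) where
  toFun := colorGiven p
  measurable' := measurable_colorGiven p

/-- The law `Φ_p(ν)` of the color process with parameter `p` of the random equivalence
relation `ν`: pick a partition according to `ν`, then color it. -/
noncomputable def colorLaw {V : Type*} [Countable V] (p : unitInterval)
    (ν : Measure (Setoid V)) : Measure (V → Bool) :=
  ν.bind (colorKernel V p)

/-! ### The equivalence relation on `ℤ` induced by a process on the edges of `ℤ`

The edge between `i` and `i + 1` is indexed by `i`; an edge configuration with values in `{-1, 1}`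
is a map `ℤ → Bool`, where `true` stands for `1` and `false` for `-1`. -/

/-- Two integers are equivalent iff all edges between them have the value `1`. -/
def edgePartition (y : ℤ → Bool) : Setoid ℤ where
  r m n := ∀ i, min m n ≤ i → i < max m n → y i = true
  iseqv :=
    { refl := fun m i h1 h2 => by simp at h1 h2; omega
      symm := fun {m n} h i h1 h2 => h i (by rwa [min_comm]) (by rwa [max_comm])
      trans := fun {a b c} h h' i h1 h2 => by
        by_cases hi : min a b ≤ i ∧ i < max a b
        · exact h i hi.1 hi.2
        · exact h' i (by omega) (by omega) }

theorem measurable_edgePartition : Measurable edgePartition := by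
  refine measurable_generateFrom ?_
  rintro _ ⟨⟨m, n⟩, rfl⟩
  have : edgePartition ⁻¹' {r : Setoid ℤ | r m n}
      = ⋂ i : ℤ, ({_y : ℤ → Bool | min m n ≤ i ∧ i < max m n}ᶜ ∪ {y : ℤ → Bool | y i = true}) := by
    ext y
    simp only [Set.mem_preimage, Set.mem_ofPred_eq, Set.mem_iInter, Set.mem_union,
      Set.mem_compl_iff, ← imp_iff_not_or, and_imp]
    rfl
  rw [this]
  exact MeasurableSet.iInter fun i => (MeasurableSet.const _).compl.union
    (measurableSet_eq_fun (measurable_pi_apply i) measurable_const)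

/-- The law of the color process `X^{Y,p}` on `ℤ`, where `Y` is an edge process with law `μ`. -/
noncomputable def edgeColorLaw (p : unitInterval) (μ : Measure (ℤ → Bool)) :
    Measure (ℤ → Bool) :=
  colorLaw p (μ.map edgePartition)

/-! ### The Ising model on the edges of `ℤ` -/

/-- The numerical value `1` or `-1` of a spin. -/
def spin (b : Bool) : ℝ := if b then 1 else -1

/-- `J ∑ x(e_i) x(e_{i+1}) + ∑ h(e_i) x(e_i)` on the edges `e_m, …, e_{n-1}` of `[m, n]`. -/
noncomputable def isingExponent (J : ℝ) (h : ℤ → ℝ) (m n : ℤ) (x : ℤ → Bool) : ℝ :=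
  J * ∑ i ∈ Finset.Ico m (n - 1), spin (x i) * spin (x (i + 1))
    + ∑ i ∈ Finset.Ico m n, h i * spin (x i)

/-- Extension of a configuration on the edges of `[m, n]` to all edges, by `1` outside. -/
noncomputable def extendEdges (m n : ℤ) (x : Finset.Ico m n → Bool) : ℤ → Bool :=
  fun i => if hi : i ∈ Finset.Ico m n then x ⟨i, hi⟩ else true

/-- The normalizing constant. -/
noncomputable def isingPartition (J : ℝ) (h : ℤ → ℝ) (m n : ℤ) : ℝ :=
  ∑ x : Finset.Ico m n → Bool, Real.exp (isingExponent J h m n (extendEdges m n x))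

/-- The Ising probability of a configuration on the edges of `[m, n]`. -/
noncomputable def isingProb (J : ℝ) (h : ℤ → ℝ) (m n : ℤ) (x : Finset.Ico m n → Bool) : ℝ :=
  Real.exp (isingExponent J h m n (extendEdges m n x)) / isingPartition J h m n

/-- The Ising model on the edges of `[m, n]` (free boundary conditions), as a law on configurations
on all edges of `ℤ`: outside `[m, n]` the configuration is frozen to `1`, which does not
influence the law inside. -/
noncomputable def isingMeasure (J : ℝ) (h : ℤ → ℝ) (m n : ℤ) : Measure (ℤ → Bool) :=
  ∑ x : Finset.Ico m n → Bool,
    ENNReal.ofReal (isingProb J h m n x) • Measure.dirac (extendEdges m n x)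

instance (J : ℝ) (h : ℤ → ℝ) (m n : ℤ) : IsProbabilityMeasure (isingMeasure J h m n) := by
  constructor
  have hZ : 0 < isingPartition J h m n :=
    Finset.sum_pos (fun _ _ => Real.exp_pos _) Finset.univ_nonempty
  simp only [isingMeasure, Measure.finsetSum_apply, Measure.smul_apply, smul_eq_mul,
    measure_univ, mul_one]
  have h0 : ∀ x ∈ (Finset.univ : Finset (Finset.Ico m n → Bool)), 0 ≤ isingProb J h m n x :=
    fun x _ => div_nonneg (Real.exp_pos _).le hZ.le
  rw [← ENNReal.ofReal_sum_of_nonneg h0]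
  simp only [isingProb]
  rw [← Finset.sum_div, ← isingPartition, div_self hZ.ne', ENNReal.ofReal_one]

/-- `isingMeasure` as an element of the space of probability measures with weak convergence. -/
noncomputable def isingLaw (J : ℝ) (h : ℤ → ℝ) (m n : ℤ) : ProbabilityMeasure (ℤ → Bool) :=
  ⟨isingMeasure J h m n, inferInstance⟩

/-- `μ` is the Ising model on the edges of `ℤ`: the limit in distribution (weak limit, for the
product topology) of the Ising models on the edges of `[m, n]` as `m → -∞` and `n → ∞`. -/
def IsEdgeIsing (J : ℝ) (h : ℤ → ℝ) (μ : ProbabilityMeasure (ℤ → Bool)) : Prop :=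
  Tendsto (fun mn : ℤ × ℤ => isingLaw J h mn.1 mn.2) (atBot ×ˢ atTop) (𝓝 μ)

/-! ### `n`-step Markov processes -/

/-- The event that the process agrees with `a` at the `m` times `k - m, …, k - 1` before `k`. -/
def pastEvent (a : ℤ → Bool) (k : ℤ) (m : ℕ) : Set (ℤ → Bool) :=
  {x | ∀ j, k - m ≤ j → j < k → x j = a j}

/-- A `{0,1}`-valued process indexed by `ℤ` with law `P` is `n`-step Markov: conditionally on any
past of length at least `n` that has positive probability, the law of the value at time `k` is
the conditional law given the last `n` values only. -/
def IsStepMarkov (n : ℕ) (P : Measure (ℤ → Bool)) : Prop :=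
  ∀ (k : ℤ) (m : ℕ), n ≤ m → ∀ a : ℤ → Bool, P (pastEvent a k m) ≠ 0 →
    cond P (pastEvent a k m) {x | x k = a k} = cond P (pastEvent a k n) {x | x k = a k}

end DivideColor

/-! The Ising chain is governed by a symmetric 2 × 2 transfer matrix `K` with positive entries and,
since `J > 0`, positive determinant. Normalized iterates of `K` on the boundary vector converge to a
positive eigenvector `v`, with `K v = lam v` (`exists_perron`). Hence expectations of products over
a finite window converge. Compactness of the space of laws on `{0,1}^ℤ` and uniqueness of the
cluster point then give the infinite-volume limit (`exists_isEdgeIsing`).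

For the color process the words `1 0 ⋯ 0` suffice. Given `Y`, such a word requires the first edge to
carry `-1`; then it has probability `p (1 - p)` times a factor `q = 1 - p` for each later edge
carrying `-1`, because each such edge opens a new class (`colorGiven_oneZeros`). Averaging over `Y`,
the word with `L + 1` zeros has probability proportional to `(B ^ L v)(false) / lam ^ L`, where `B =
K D` and `D = diag(1, q)`.

If the process were `n`-step Markov, appending a zero would multiply this probability by a constant
once the word has at least `n` zeros (`IsStepMarkov.exists_oneZeros_eq`). Since `B` is injective
with nonzero off-diagonal entry, this forces `B v = c v`. Then `(K - B) v`, a nonzero multiple of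
the `false` column of `K`, is parallel to `v`; so that column is an eigenvector of `K`. As `K` is
invertible, the basis vector of `false` is then an eigenvector too, which the positive off-diagonal
entry excludes (`not_eventually_geometric`). For `p ∈ {0, 1}` the process is deterministic. -/

namespace DivideColor

/-! ### Transfer operators on two spins -/

/-- The entries of the symmetric transfer matrix of the Ising chain. -/
noncomputable def transferWeight (J h : ℝ) (b c : Bool) : ℝ :=
  Real.exp (J * (spin b * spin c) + h * (spin b + spin c) / 2)

/-- The symmetric transfer matrix of the Ising chain, as an operator. -/
noncomputable def transfer (J h : ℝ) : Module.End ℝ (Bool → ℝ) :=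
  (Matrix.of (transferWeight J h)).mulVecLin

/-- The contribution of the external field at an end of the chain. -/
noncomputable def boundaryWeight (h : ℝ) (b : Bool) : ℝ := Real.exp (h * spin b / 2)

theorem transferWeight_pos (J h : ℝ) (b c : Bool) : 0 < transferWeight J h b c :=
  Real.exp_pos _

theorem transferWeight_comm (J h : ℝ) (b c : Bool) :
    transferWeight J h b c = transferWeight J h c b := by
  simp only [transferWeight, mul_comm (spin b), add_comm (spin b)]

/-- The field cancels on both sides: the comparison is between `exp (-2J)` and `exp (2J)`. This is
where ferromagnetism enters, and it makes the transfer matrix invertible. -/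
theorem transferWeight_det_pos {J : ℝ} (hJ : 0 < J) (h : ℝ) :
    transferWeight J h true false ^ 2
      < transferWeight J h true true * transferWeight J h false false := by
  rw [transferWeight, transferWeight, transferWeight, ← Real.exp_add, ← Real.exp_nat_mul]
  refine Real.exp_lt_exp.2 ?_
  simp only [spin, if_true, Bool.false_eq_true, if_false]
  push_cast
  nlinarith

theorem transfer_apply (J h : ℝ) (g : Bool → ℝ) (b : Bool) :
    transfer J h g b = ∑ c, transferWeight J h b c * g c := rfl

theorem sum_mul_transfer (J h : ℝ) (u g : Bool → ℝ) :
    ∑ b, u b * transfer J h g b = ∑ b, transfer J h u b * g b := by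
  simp only [transfer_apply, Fintype.sum_bool, transferWeight_comm J h false true]
  ring

/-- Self-adjointness lets the iterates to the left of a window act on the left boundary vector. -/
theorem sum_mul_transfer_pow (J h : ℝ) (n : ℕ) (u g : Bool → ℝ) :
    ∑ b, u b * (transfer J h ^ n) g b = ∑ b, (transfer J h ^ n) u b * g b := by
  induction n generalizing u g with
  | zero => rfl
  | succ n ih =>
    rw [pow_succ', Module.End.mul_apply, sum_mul_transfer, ih, ← Module.End.mul_apply, ← pow_succ,
      pow_succ']

/-- The transfer operator has a positive eigenvector, which attracts every positive vector under
normalized iteration. -/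
theorem exists_perron {J : ℝ} (hJ : 0 < J) (h : ℝ) {w : Bool → ℝ} (hw : ∀ b, 0 < w b) :
    ∃ (lam : ℝ) (v : Bool → ℝ), 0 < lam ∧ (∀ b, 0 < v b) ∧ transfer J h v = lam • v ∧
      Tendsto (fun n : ℕ => (lam ^ n)⁻¹ • (transfer J h ^ n) w) atTop (𝓝 v) := by
  have hdet := transferWeight_det_pos hJ h
  have hcomm := transferWeight_comm J h false true
  have ha := transferWeight_pos J h true true
  have hb := transferWeight_pos J h true false
  have hd := transferWeight_pos J h false false
  set a := transferWeight J h true true with ha'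
  set b := transferWeight J h true false with hb'
  set d := transferWeight J h false false with hd'
  -- The eigenvalues are `(a + d) / 2 ± r`; `lam` takes the plus sign.
  obtain ⟨r, hr, hr2⟩ : ∃ r : ℝ, 0 < r ∧ r ^ 2 = ((a - d) / 2) ^ 2 + b ^ 2 :=
    ⟨Real.sqrt (((a - d) / 2) ^ 2 + b ^ 2), Real.sqrt_pos.2 (by positivity),
      Real.sq_sqrt (by positivity)⟩
  set lam := (a + d) / 2 + r with hlam
  have hl : 0 < lam := by positivity
  have hla : 0 < lam - a := by
    have : (a - d) / 2 < r := by
      refine lt_of_pow_lt_pow_left₀ 2 hr.le ?_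
      rw [hr2]
      have := pow_pos hb 2
      linarith
    rw [hlam]
    linarith
  have hchar : (lam - a) * (lam - d) = b ^ 2 := by
    rw [hlam]
    nlinarith
  have key : ∀ (g : Bool → ℝ), transfer J h g =
      fun c => if c then a * g true + b * g false else b * g true + d * g false := by
    intro g
    funext c
    cases c <;> simp [transfer_apply, ← ha', ← hb', ← hd', hcomm]
  have hv0 : transfer J h (fun c => if c then b else lam - a)
      = lam • (fun c => if c then b else lam - a) := by
    rw [key]
    funext c
    cases c <;> simp <;> nlinarith
  -- The other eigenvalue is the trace minus `lam`, with eigenvector orthogonal to the first.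
  have hv1 : transfer J h (fun c => if c then -(lam - a) else b)
      = (a + d - lam) • (fun c => if c then -(lam - a) else b) := by
    rw [key]
    funext c
    cases c <;> simp <;> nlinarith
  set v0 : Bool → ℝ := fun c => if c then b else lam - a with hv0'
  set v1 : Bool → ℝ := fun c => if c then -(lam - a) else b with hv1'
  have hN : 0 < b ^ 2 + (lam - a) ^ 2 := by positivity
  have hpow : ∀ {u : Bool → ℝ} {e : ℝ}, transfer J h u = e • u →
      ∀ n : ℕ, (transfer J h ^ n) u = e ^ n • u := by
    intro u e hu n
    induction n with
    | zero => simp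
    | succ n ih => rw [pow_succ, Module.End.mul_apply, hu, map_smul, ih, smul_smul, pow_succ']
  set α := (w true * b + w false * (lam - a)) / (b ^ 2 + (lam - a) ^ 2) with hα
  set β := (-(w true * (lam - a)) + w false * b) / (b ^ 2 + (lam - a) ^ 2) with hβ
  -- Up to normalization `α` is the inner product of two positive vectors.
  have hα0 : 0 < α :=
    div_pos (add_pos (mul_pos (hw _) hb) (mul_pos (hw _) hla)) hN
  have hdecomp : w = α • v0 + β • v1 := by
    funext c
    cases c <;> simp [hv0', hv1', hα, hβ] <;> field_simp <;> ring
  refine ⟨lam, α • v0, hl, fun c => ?_, ?_, ?_⟩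
  · cases c <;> simp [hv0'] <;> positivity
  · rw [map_smul, hv0, smul_comm]
  -- The spectral gap: the second eigenvalue lies below `lam` because `r > 0`, and above `-lam`
  -- because the trace is positive.
  · have hratio : Tendsto (fun n : ℕ => ((a + d - lam) / lam) ^ n) atTop (𝓝 0) := by
      refine tendsto_pow_atTop_nhds_zero_of_abs_lt_one ?_
      rw [abs_div, abs_of_pos hl, div_lt_one hl, abs_lt]
      constructor
      · linarith
      · rw [hlam]; linarith
    have heq : ∀ n : ℕ, (lam ^ n)⁻¹ • (transfer J h ^ n) w
        = α • v0 + ((a + d - lam) / lam) ^ n • (β • v1) := by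
      intro n
      have hln := pow_pos hl n
      rw [hdecomp, map_add, map_smul, map_smul, hpow hv0, hpow hv1, smul_add, div_pow]
      congr 1
      · rw [smul_comm α, smul_smul, inv_mul_cancel₀ hln.ne', one_smul]
      · rw [smul_comm β, smul_smul, div_eq_inv_mul]
    simp only [heq]
    simpa using tendsto_const_nhds.add (hratio.smul_const (β • v1))

/-- `chain K F L g = F 0 * K (F 1 * K (⋯ * (F L * g)))`. -/
def chain (K : Module.End ℝ (Bool → ℝ)) : (ℕ → Bool → ℝ) → ℕ → (Bool → ℝ) → Bool → ℝ
  | F, 0, g => F 0 * g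
  | F, L + 1, g => F 0 * K (chain K (fun i => F (i + 1)) L g)

theorem chain_congr (K : Module.End ℝ (Bool → ℝ)) {F G : ℕ → Bool → ℝ} {L : ℕ}
    (hFG : ∀ i ≤ L, F i = G i) (g : Bool → ℝ) : chain K F L g = chain K G L g := by
  induction L generalizing F G with
  | zero => simp [chain, hFG 0 le_rfl]
  | succ L ih =>
    rw [chain, chain, hFG 0 (Nat.zero_le _), ih fun i hi => hFG (i + 1) (by omega)]

/-- A chain of index `L` has `L + 1` factors and `L` operators, so cutting it in two frees one
operator at the cut. -/
theorem chain_add (K : Module.End ℝ (Bool → ℝ)) (F : ℕ → Bool → ℝ) (L M : ℕ) (g : Bool → ℝ) :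
    chain K F (L + M + 1) g = chain K F L (K (chain K (fun i => F (L + 1 + i)) M g)) := by
  induction L generalizing F with
  | zero =>
    rw [Nat.zero_add, chain, chain]
    simp only [Nat.zero_add, Nat.add_comm 1]
  | succ L ih =>
    rw [show L + 1 + M + 1 = (L + M + 1) + 1 by omega, chain, ih, chain]
    simp only [show ∀ i, L + 1 + i + 1 = L + 1 + 1 + i by intro i; omega]

theorem chain_one (K : Module.End ℝ (Bool → ℝ)) (L : ℕ) (g : Bool → ℝ) :
    chain K 1 L g = (K ^ L) g := by
  induction L with
  | zero => simp [chain]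
  | succ L ih =>
    have : (fun i : ℕ => (1 : ℕ → Bool → ℝ) (i + 1)) = 1 := rfl
    rw [chain, this, ih, pow_succ', Module.End.mul_apply, Pi.one_apply, one_mul]

theorem chain_smul (K : Module.End ℝ (Bool → ℝ)) (F : ℕ → Bool → ℝ) (L : ℕ) (c : ℝ)
    (g : Bool → ℝ) : chain K F L (c • g) = c • chain K F L g := by
  induction L generalizing F with
  | zero => simp [chain]
  | succ L ih => rw [chain, chain, ih, map_smul, mul_smul_comm]

theorem continuous_chain (K : Module.End ℝ (Bool → ℝ)) (F : ℕ → Bool → ℝ) (L : ℕ) :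
    Continuous (chain K F L) := by
  induction L generalizing F with
  | zero => exact continuous_const.mul continuous_id
  | succ L ih =>
    exact continuous_const.mul (K.continuous_of_finiteDimensional.comp (ih fun i => F (i + 1)))

/-- If all the factors except for the first one are equal to `D`, the chain is an iterate. -/
theorem chain_of_forall_succ (K : Module.End ℝ (Bool → ℝ)) {F : ℕ → Bool → ℝ} {D : Bool → ℝ}
    (hF : ∀ i, F (i + 1) = D) (L : ℕ) (g : Bool → ℝ) :
    chain K F L g = F 0 * ((K * LinearMap.mulLeft ℝ D) ^ L) g := by
  induction L generalizing F with
  | zero => simp [chain]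
  | succ L ih =>
    rw [chain, ih fun i => hF (i + 1), pow_succ', Module.End.mul_apply, Module.End.mul_apply, hF]
    rfl

/-- The transfer matrix expansion of a chain. -/
theorem sum_prod_eq_sum_mul_chain (J h : ℝ) (F : ℕ → Bool → ℝ) (L : ℕ) (u g : Bool → ℝ) :
    ∑ x : Fin (L + 1) → Bool, u (x 0) * (∏ i : Fin (L + 1), F i (x i))
        * (∏ i : Fin L, transferWeight J h (x i.castSucc) (x i.succ)) * g (x (Fin.last L))
      = ∑ b, u b * chain (transfer J h) F L g b := by
  induction L generalizing F u with
  | zero =>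
    rw [← (Equiv.funUnique (Fin 1) Bool).symm.sum_comp]
    simp [chain, mul_assoc]
  | succ L ih =>
    rw [← (Fin.consEquiv fun _ => Bool).sum_comp, Fintype.sum_prod_type]
    refine Finset.sum_congr rfl fun b _ => ?_
    rw [chain, Pi.mul_apply, transfer_apply, ← ih, Finset.mul_sum, Finset.mul_sum]
    refine Finset.sum_congr rfl fun x _ => ?_
    simp only [Fin.consEquiv_apply, Fin.prod_univ_succ, Fin.cons_zero, Fin.cons_succ,
      Fin.castSucc_zero, ← Fin.succ_last, Fin.val_succ, Fin.val_zero, ← Fin.succ_castSucc]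
    ring

/-- In a two-state chain with positive and invertible transfer matrix, the survival weights of a
nontrivial killing `D` are not eventually geometric. -/
theorem not_eventually_geometric {J : ℝ} (hJ : 0 < J) (h : ℝ) {q : ℝ} (hq : 0 < q) (hq1 : q < 1)
    {lam : ℝ} {v : Bool → ℝ} (hv : ∀ b, 0 < v b) (hKv : transfer J h v = lam • v) (n : ℕ) (c : ℝ)
    (hgeo : ∀ L, n ≤ L →
      ((transfer J h * LinearMap.mulLeft ℝ (fun b : Bool => if b then 1 else q)) ^ (L + 1)) v false
        = c * ((transfer J h * LinearMap.mulLeft ℝ (fun b : Bool => if b then 1 else q)) ^ L)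
          v false) : False := by
  have hdet := transferWeight_det_pos hJ h
  have hcomm := transferWeight_comm J h false true
  have hb := transferWeight_pos J h true false
  have hkey : ∀ (g : Bool → ℝ) (b : Bool), transfer J h g b
      = transferWeight J h b true * g true + transferWeight J h b false * g false := by
    intro g b
    simp [transfer_apply]
  set a := transferWeight J h true true
  set b := transferWeight J h true false
  set d := transferWeight J h false false
  set B : Module.End ℝ (Bool → ℝ) :=
    transfer J h * LinearMap.mulLeft ℝ (fun b : Bool => if b then 1 else q) with hB
  have hBt : ∀ g, B g true = a * g true + b * (q * g false) := by
    intro g; simp [hB, hkey, a, b]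
  have hBf : ∀ g, B g false = b * g true + d * (q * g false) := by
    intro g; simp [hB, hkey, hcomm, b, d]
  have hinj : ∀ g, B g = 0 → g = 0 := by
    intro g hg
    have h1 := hBt g
    have h2 := hBf g
    rw [hg, Pi.zero_apply] at h1 h2
    have h3 : (a * d - b ^ 2) * g true = 0 := by linear_combination b * h2 - d * h1
    have h4 : (a * d - b ^ 2) * (q * g false) = 0 := by linear_combination b * h1 - a * h2
    have hne : a * d - b ^ 2 ≠ 0 := by linarith
    have h5 := (mul_eq_zero.1 h3).resolve_left hne
    have h6 := (mul_eq_zero.1 ((mul_eq_zero.1 h4).resolve_left hne)).resolve_left hq.ne'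
    funext s
    cases s <;> assumption
  have hinjpow : ∀ (m : ℕ) (g), (B ^ m) g = 0 → g = 0 := by
    intro m
    induction m with
    | zero => intro g hg; simpa using hg
    | succ m ih =>
      intro g hg
      rw [pow_succ, Module.End.mul_apply] at hg
      exact hinj g (ih _ hg)
  have hstep : ∀ m g, (B ^ (m + 1)) g = B ((B ^ m) g) := by
    intro m g
    rw [pow_succ', Module.End.mul_apply]
  -- Two consecutive relations determine the defect `z`: they give `z false = 0` and `B z false =
  -- 0`, and the latter is `b * z true = 0`.
  have hz : B ((B ^ n) v) - c • (B ^ n) v = 0 := by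
    have h1 := hgeo n le_rfl
    have h2 := hgeo (n + 1) (by omega)
    set z := B ((B ^ n) v) - c • (B ^ n) v with hzdef
    have hzf : z false = 0 := by
      simp [hzdef, ← hstep, h1]
    have hBz : B z false = 0 := by
      rw [hzdef, map_sub, map_smul, ← hstep, ← hstep]
      simp [h2]
    rw [hBf, hzf, mul_zero, mul_zero, add_zero] at hBz
    funext s
    cases s
    · exact hzf
    · exact (mul_eq_zero.1 hBz).resolve_left hb.ne'
  -- The defect is `B ^ n` applied to `B v - c v`, and `B ^ n` is injective.
  have hBv : B v - c • v = 0 := by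
    refine hinjpow n _ ?_
    rw [map_sub, map_smul, ← hz, ← hstep, pow_succ, Module.End.mul_apply (B ^ n) B]
  have e1 := congrFun hBv true
  have e2 := congrFun hBv false
  have f1 := congrFun hKv true
  have f2 := congrFun hKv false
  simp only [Pi.sub_apply, Pi.smul_apply, smul_eq_mul, Pi.zero_apply, hBt, hBf, hkey, hcomm]
    at e1 e2 f1 f2
  change a * v true + b * v false = _ at f1
  change b * v true + d * v false = _ at f2
  -- Both `K v` and `B v` are parallel to `v`, hence so is `(K - B) v = (1 - q) * v false * (b, d)`;
  -- the cross product with `v` eliminates `lam` and `c`.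
  have h1 : (1 - q) * v false * (b * v false - d * v true) = 0 := by
    linear_combination v false * f1 - v true * f2 - v false * e1 + v true * e2
  have hqv : (1 - q) * v false ≠ 0 := (mul_pos (by linarith) (hv false)).ne'
  have h2 := (mul_eq_zero.1 h1).resolve_left hqv
  have h3 : (a * d - b ^ 2) * v true = 0 := by
    linear_combination d * f1 - b * f2 - lam * h2
  have : 0 < (a * d - b ^ 2) * v true := mul_pos (by linarith) (hv true)
  linarith

end DivideColor

namespace DivideColor

/-! ### The Ising model on a finite interval -/

theorem sum_Ico_int {M : Type*} [AddCommMonoid M] (f : ℤ → M) (m : ℤ) (N : ℕ) :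
    ∑ i ∈ Finset.Ico m (m + N), f i = ∑ i ∈ Finset.range N, f (m + i) := by
  refine (Finset.sum_nbij (fun i : ℕ => m + (i : ℤ)) ?_ ?_ ?_ fun _ _ => rfl).symm
  · intro i hi
    have := Finset.mem_range.1 hi
    simp only [Finset.mem_Ico]
    omega
  · intro i _ j _ hij
    simpa using hij
  · intro i hi
    have := Finset.mem_Ico.1 (Finset.mem_coe.1 hi)
    refine ⟨(i - m).toNat, ?_, ?_⟩
    · simp only [Finset.coe_range, Set.mem_Iio]
      omega
    · simp only
      omega

/-- The Boltzmann weight as a product of transfer weights. -/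
theorem exp_isingExponent (J h : ℝ) (m : ℤ) (N : ℕ) (y : ℤ → Bool) :
    Real.exp (isingExponent J (fun _ => h) m (m + (N + 1 : ℕ)) y)
      = boundaryWeight h (y m)
        * (∏ i ∈ Finset.range N, transferWeight J h (y (m + i)) (y (m + (i + 1 : ℕ))))
        * boundaryWeight h (y (m + N)) := by
  simp only [boundaryWeight, transferWeight]
  rw [← Real.exp_sum, ← Real.exp_add, ← Real.exp_add]
  congr 1
  -- The symmetric transfer weight gives each spin half its field from each neighbor; the two ends
  -- lack one half, which `boundaryWeight` supplies.
  rw [isingExponent, show m + ((N + 1 : ℕ) : ℤ) - 1 = m + (N : ℕ) by push_cast; ring,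
    sum_Ico_int, sum_Ico_int]
  induction N with
  | zero => simp
  | succ N ih =>
    simp only [Finset.sum_range_succ] at ih ⊢
    push_cast at ih ⊢
    simp only [add_assoc] at ih ⊢
    linear_combination ih

theorem extendEdges_apply {m n : ℤ} (x : Finset.Ico m n → Bool) (i : Finset.Ico m n) :
    extendEdges m n x i = x i := by
  rw [extendEdges, dif_pos i.2]

/-- Reindexing of sums over configurations in a finite interval. -/
theorem sum_extendEdges (m : ℤ) (N : ℕ) (Ψ : (Fin N → Bool) → ℝ) :
    ∑ x : Finset.Ico m (m + N) → Bool, Ψ (fun i => extendEdges m (m + N) x (m + (i : ℕ)))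
      = ∑ z, Ψ z := by
  have hmem : ∀ i : Fin N, m + ((i : ℕ) : ℤ) ∈ Finset.Ico m (m + (N : ℤ)) := by
    intro i
    have := i.2
    rw [Finset.mem_Ico]
    omega
  let e : Fin N ≃ Finset.Ico m (m + (N : ℤ)) :=
    { toFun := fun i => ⟨m + (i : ℕ), hmem i⟩
      invFun := fun j => ⟨((j : ℤ) - m).toNat, by have := Finset.mem_Ico.1 j.2; omega⟩
      left_inv := fun i => by ext; simp
      right_inv := fun j => by
        have := Finset.mem_Ico.1 j.2
        ext
        simp only
        omega }
  rw [← (Equiv.arrowCongr e (Equiv.refl Bool)).symm.sum_comp]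
  refine Finset.sum_congr rfl fun x _ => congrArg Ψ (funext fun i => ?_)
  exact extendEdges_apply x (e i)

theorem integral_isingMeasure (J : ℝ) (h : ℤ → ℝ) (m n : ℤ) (G : (ℤ → Bool) → ℝ) :
    ∫ y, G y ∂(isingMeasure J h m n)
      = (∑ x, Real.exp (isingExponent J h m n (extendEdges m n x)) * G (extendEdges m n x))
        / isingPartition J h m n := by
  have hZ : 0 ≤ isingPartition J h m n := Finset.sum_nonneg fun _ _ => (Real.exp_pos _).le
  rw [isingMeasure, integral_finsetSum_measure, Finset.sum_div]
  · refine Finset.sum_congr rfl fun x _ => ?_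
    rw [integral_smul_measure, integral_dirac, isingProb,
      ENNReal.toReal_ofReal (div_nonneg (Real.exp_pos _).le hZ), smul_eq_mul]
    ring
  · intro x _
    exact (integrable_dirac (by simp)).smul_measure ENNReal.ofReal_ne_top

/-- Transfer matrix expansion of unnormalized expectations of product functions. -/
theorem sum_exp_isingExponent_mul_prod (J h : ℝ) (m : ℤ) (N : ℕ) (F : ℕ → Bool → ℝ) :
    ∑ x, Real.exp (isingExponent J (fun _ => h) m (m + (N + 1 : ℕ))
          (extendEdges m (m + (N + 1 : ℕ)) x))
        * ∏ i ∈ Finset.range (N + 1), F i (extendEdges m (m + (N + 1 : ℕ)) x (m + i))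
      = ∑ b, boundaryWeight h b * chain (transfer J h) F N (boundaryWeight h) b := by
  rw [← sum_prod_eq_sum_mul_chain, ← sum_extendEdges m (N + 1)]
  refine Finset.sum_congr rfl fun x _ => ?_
  rw [exp_isingExponent, Finset.prod_range, Finset.prod_range]
  simp only [Fin.val_zero, Fin.val_castSucc, Fin.val_succ, Fin.val_last, Nat.cast_zero, add_zero]
  ring

theorem isingPartition_eq (J h : ℝ) (m : ℤ) (N : ℕ) :
    isingPartition J (fun _ => h) m (m + (N + 1 : ℕ))
      = ∑ b, boundaryWeight h b * chain (transfer J h) 1 N (boundaryWeight h) b := by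
  rw [← sum_exp_isingExponent_mul_prod J h m N, isingPartition]
  simp

/-- Chains which are trivial outside of a window. -/
theorem sum_mul_chain_window (J h : ℝ) (s L r : ℕ) (F : ℕ → Bool → ℝ) (w : Bool → ℝ) :
    ∑ b, w b * chain (transfer J h)
        (fun i => if s + 1 ≤ i ∧ i < s + 1 + (L + 1) then F (i - (s + 1)) else 1)
        (s + (L + r + 1) + 1) w b
      = ∑ b, (transfer J h ^ (s + 1)) w b
          * chain (transfer J h) F L ((transfer J h ^ (r + 1)) w) b := by
  rw [chain_add, chain_add, ← sum_mul_transfer_pow, pow_succ _ s]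
  refine Finset.sum_congr rfl fun b _ => ?_
  have h1 : ∀ g, chain (transfer J h)
      (fun i => if s + 1 ≤ i ∧ i < s + 1 + (L + 1) then F (i - (s + 1)) else 1) s g
      = (transfer J h ^ s) g := fun g => by
    rw [← chain_one]
    refine chain_congr _ (fun i hi => ?_) g
    rw [if_neg (by omega)]
    rfl
  have h2 : ∀ g, chain (transfer J h) (fun i => if s + 1 ≤ s + 1 + i ∧
      s + 1 + i < s + 1 + (L + 1) then F (s + 1 + i - (s + 1)) else 1) L g
      = chain (transfer J h) F L g := fun g => by
    refine chain_congr _ (fun i hi => ?_) g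
    rw [if_pos (by omega), Nat.add_sub_cancel_left]
  have h3 : ∀ g, chain (transfer J h) (fun i => if s + 1 ≤ s + 1 + (L + 1 + i) ∧
      s + 1 + (L + 1 + i) < s + 1 + (L + 1) then F (s + 1 + (L + 1 + i) - (s + 1)) else 1) r g
      = (transfer J h ^ r) g := fun g => by
    rw [← chain_one]
    refine chain_congr _ (fun i hi => ?_) g
    rw [if_neg (by omega)]
    rfl
  rw [h1, h2, h3, pow_succ' _ r, Module.End.mul_apply, Module.End.mul_apply]

/-- Expectations of product functions in the Ising model on a finite interval. -/
theorem integral_isingMeasure_prod (J h : ℝ) (k : ℤ) (s L r : ℕ) (F : ℕ → Bool → ℝ) :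
    ∫ y, ∏ i ∈ Finset.range (L + 1), F i (y (k + i))
        ∂(isingMeasure J (fun _ => h) (k - (s + 1 : ℕ)) (k + (L + r + 2 : ℕ)))
      = (∑ b, (transfer J h ^ (s + 1)) (boundaryWeight h) b
          * chain (transfer J h) F L ((transfer J h ^ (r + 1)) (boundaryWeight h)) b)
        / ∑ b, (transfer J h ^ (s + 1)) (boundaryWeight h) b
          * chain (transfer J h) 1 L ((transfer J h ^ (r + 1)) (boundaryWeight h)) b := by
  rw [integral_isingMeasure, show k + ((L + r + 2 : ℕ) : ℤ)
    = (k - (s + 1 : ℕ)) + ((s + (L + r + 1) + 1 + 1 : ℕ) : ℤ) by push_cast; ring,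
    isingPartition_eq, ← sum_mul_chain_window, ← sum_mul_chain_window]
  congr 1
  · rw [← sum_exp_isingExponent_mul_prod J h (k - (s + 1 : ℕ))]
    refine Finset.sum_congr rfl fun x _ => ?_
    congr 1
    generalize extendEdges (k - (s + 1 : ℕ)) _ x = y
    -- There are `s + 1` trivial factors before the window of `L + 1` edges and `r + 1` after it.
    have h1 : ∀ P : ℕ → ℝ, (∀ i, ¬(s + 1 ≤ i ∧ i < s + 1 + (L + 1)) → P i = 1) →
        ∏ i ∈ Finset.range (s + (L + r + 1) + 1 + 1), P i
          = ∏ i ∈ Finset.range (L + 1), P (s + 1 + i) := by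
      intro P hP
      rw [show s + (L + r + 1) + 1 + 1 = (s + 1) + ((L + 1) + (r + 1)) by ring,
        Finset.prod_range_add _ (s + 1), Finset.prod_range_add _ (L + 1), Finset.prod_eq_one, one_mul,
        Finset.prod_eq_one (s := Finset.range (r + 1)), mul_one]
      · exact fun i _ => hP _ (by omega)
      · intro i hi
        have := Finset.mem_range.1 hi
        exact hP _ (by omega)
    rw [h1 _ fun i hi => by rw [if_neg hi]; rfl]
    refine Finset.prod_congr rfl fun i hi => ?_
    have := Finset.mem_range.1 hi
    rw [if_pos (by omega), Nat.add_sub_cancel_left]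
    congr 2
    push_cast
    ring
  · simp only [Pi.one_apply, ite_self]
    rfl

end DivideColor

namespace DivideColor

/-! ### The infinite-volume limit -/

theorem continuous_prod_window (k : ℤ) (L : ℕ) (F : ℕ → Bool → ℝ) :
    Continuous fun y : ℤ → Bool => ∏ i ∈ Finset.range L, F i (y (k + i)) :=
  continuous_finsetProd _ fun _ _ => continuous_of_discreteTopology.comp (continuous_apply _)

/-- A product of functions of the spins in a window, as a bounded continuous function. -/
noncomputable def windowFunction (k : ℤ) (L : ℕ) (F : ℕ → Bool → ℝ) :
    BoundedContinuousFunction (ℤ → Bool) ℝ :=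
  BoundedContinuousFunction.mkOfCompact ⟨_, continuous_prod_window k L F⟩

/-- Convergence of the expectations of product functions in the infinite-volume limit. -/
theorem tendsto_integral_isingMeasure {J h lam : ℝ} {v : Bool → ℝ} (hlam : 0 < lam)
    (hv : ∀ b, 0 < v b) (hKv : transfer J h v = lam • v)
    (hlim : Tendsto (fun n : ℕ => (lam ^ n)⁻¹ • (transfer J h ^ n) (boundaryWeight h)) atTop (𝓝 v))
    (k : ℤ) (L : ℕ) (F : ℕ → Bool → ℝ) :
    Tendsto (fun mn : ℤ × ℤ => ∫ y, ∏ i ∈ Finset.range (L + 1), F i (y (k + i))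
        ∂(isingMeasure J (fun _ => h) mn.1 mn.2)) (atBot ×ˢ atTop)
      (𝓝 ((∑ b, v b * chain (transfer J h) F L v b) / (lam ^ L * ∑ b, v b * v b))) := by
  set u : ℕ → Bool → ℝ := fun n => (lam ^ n)⁻¹ • (transfer J h ^ n) (boundaryWeight h) with hu
  -- The numbers of edges left and right of the window are `s + 1` and `r + 1`; the truncation in
  -- `toNat` is harmless along the limit.
  set s : ℤ × ℤ → ℕ := fun mn => (k - mn.1 - 1).toNat with hs
  set r : ℤ × ℤ → ℕ := fun mn => (mn.2 - k - L - 2).toNat with hr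
  have hs_lim : Tendsto (fun mn => s mn + 1) (atBot ×ˢ atTop) atTop := by
    refine (tendsto_add_atTop_iff_nat 1).2 tendsto_id |>.comp ?_
    refine tendsto_atTop.2 fun c => ?_
    filter_upwards [tendsto_fst.eventually (eventually_le_atBot (k - 1 - c))] with mn hmn
    simp only [hs]
    omega
  have hr_lim : Tendsto (fun mn => r mn + 1) (atBot ×ˢ atTop) atTop := by
    refine (tendsto_add_atTop_iff_nat 1).2 tendsto_id |>.comp ?_
    refine tendsto_atTop.2 fun c => ?_
    filter_upwards [tendsto_snd.eventually (eventually_ge_atTop (k + L + 2 + c))] with mn hmn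
    simp only [hr]
    omega
  have hpair : ∀ F : ℕ → Bool → ℝ, Tendsto (fun mn => ∑ b, u (s mn + 1) b
      * chain (transfer J h) F L (u (r mn + 1)) b) (atBot ×ˢ atTop)
      (𝓝 (∑ b, v b * chain (transfer J h) F L v b)) := by
    intro F
    refine tendsto_finsetSum _ fun b _ => Tendsto.mul ?_ ?_
    · exact (tendsto_pi_nhds.1 hlim b).comp hs_lim
    · exact tendsto_pi_nhds.1 (((continuous_chain _ F L).tendsto v).comp (hlim.comp hr_lim)) b
  have hpow : ∀ n : ℕ, (transfer J h ^ n) v = lam ^ n • v := by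
    intro n
    induction n with
    | zero => simp
    | succ n ih => rw [pow_succ, Module.End.mul_apply, hKv, map_smul, ih, smul_smul, pow_succ']
  have hden : ∑ b, v b * chain (transfer J h) 1 L v b = lam ^ L * ∑ b, v b * v b := by
    rw [chain_one, hpow, Finset.mul_sum]
    refine Finset.sum_congr rfl fun b _ => ?_
    rw [Pi.smul_apply, smul_eq_mul]
    ring
  have hden0 : lam ^ L * ∑ b, v b * v b ≠ 0 :=
    (mul_pos (pow_pos hlam L)
      (Finset.sum_pos (fun b _ => mul_pos (hv b) (hv b)) Finset.univ_nonempty)).ne'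
  have hquot := (hpair F).div (hpair 1) (by rwa [hden])
  rw [hden] at hquot
  refine hquot.congr' ?_
  filter_upwards [tendsto_fst.eventually (eventually_le_atBot (k - 1)),
    tendsto_snd.eventually (eventually_ge_atTop (k + L + 2))] with mn h1 h2
  obtain ⟨m, n⟩ := mn
  have hm : m = k - (s (m, n) + 1 : ℕ) := by simp only [hs]; simp at h1; omega
  have hn : n = k + (L + r (m, n) + 2 : ℕ) := by simp only [hr]; simp at h2; omega
  have hint := integral_isingMeasure_prod J h k (s (m, n)) L (r (m, n)) F
  rw [← hm, ← hn] at hint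
  simp only [hint]
  -- The normalization does not depend on `F`, so it cancels in the quotient.
  have hscale : ∀ F : ℕ → Bool → ℝ, ∑ b, u (s (m, n) + 1) b
      * chain (transfer J h) F L (u (r (m, n) + 1)) b
      = ((lam ^ (s (m, n) + 1))⁻¹ * (lam ^ (r (m, n) + 1))⁻¹)
        * ∑ b, (transfer J h ^ (s (m, n) + 1)) (boundaryWeight h) b
          * chain (transfer J h) F L ((transfer J h ^ (r (m, n) + 1)) (boundaryWeight h)) b := by
    intro F
    rw [Finset.mul_sum]
    refine Finset.sum_congr rfl fun b _ => ?_
    simp only [hu, chain_smul, Pi.smul_apply, smul_eq_mul]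
    ring
  simp only [Pi.div_apply, hscale]
  exact mul_div_mul_left _ _ (mul_pos (inv_pos.2 (pow_pos hlam _)) (inv_pos.2 (pow_pos hlam _))).ne'

/-- Expectations of product functions determine a probability measure on `{0,1}^ℤ`. -/
theorem eq_of_forall_integral_prod_eq {μ ν : ProbabilityMeasure (ℤ → Bool)}
    (hμν : ∀ (k : ℤ) (L : ℕ) (F : ℕ → Bool → ℝ),
      ∫ y, ∏ i ∈ Finset.range (L + 1), F i (y (k + i)) ∂(μ : Measure (ℤ → Bool))
        = ∫ y, ∏ i ∈ Finset.range (L + 1), F i (y (k + i)) ∂(ν : Measure (ℤ → Bool))) :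
    μ = ν := by
  classical
  have := μ.2
  have := ν.2
  refine Subtype.ext ?_
  have hproj : ∀ ρ : Measure (ℤ → Bool),
      IsProjectiveLimit ρ fun I : Finset ℤ => ρ.map I.restrict := fun ρ I => rfl
  refine (hproj (μ : Measure (ℤ → Bool))).unique (fun I => ?_)
  refine Measure.ext_of_singleton fun c => ?_
  have hmeas : Measurable (I.restrict : (ℤ → Bool) → _) := Finset.measurable_restrict I
  rw [Measure.map_apply hmeas (measurableSet_singleton c),
    Measure.map_apply hmeas (measurableSet_singleton c)]
  obtain ⟨M, hM⟩ : ∃ M : ℕ, ∀ i ∈ I, -(M : ℤ) ≤ i ∧ i ≤ M := by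
    refine ⟨I.sup Int.natAbs, fun i hi => ?_⟩
    have : i.natAbs ≤ I.sup Int.natAbs := Finset.le_sup hi
    omega
  set S : Set (ℤ → Bool) := I.restrict ⁻¹' {c} with hS
  have hSm : MeasurableSet S := hmeas (measurableSet_singleton c)
  -- Sites of `[-M, M]` outside `I` receive the factor `1`, so the product is the indicator of the
  -- cylinder `S`.
  let F : ℕ → Bool → ℝ := fun i b =>
    if hi : -(M : ℤ) + i ∈ I then (if b = c ⟨_, hi⟩ then 1 else 0) else 1
  have hF : ∀ y : ℤ → Bool, ∏ i ∈ Finset.range (2 * M + 1), F i (y (-(M : ℤ) + i))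
      = S.indicator 1 y := by
    intro y
    by_cases hy : y ∈ S
    · rw [Set.indicator_of_mem hy, Pi.one_apply]
      refine Finset.prod_eq_one fun i _ => ?_
      simp only [F]
      split_ifs with hi hb
      · rfl
      · exact absurd (congrFun hy ⟨_, hi⟩) hb
      · rfl
    · rw [Set.indicator_of_notMem hy]
      obtain ⟨⟨j, hj⟩, hjne⟩ : ∃ j, I.restrict y j ≠ c j := by
        by_contra! hcon
        exact hy (funext hcon)
      have hjM := hM j hj
      have hj' : -(M : ℤ) + ((j + M).toNat : ℤ) = j := by omega
      refine Finset.prod_eq_zero (i := (j + M).toNat) (Finset.mem_range.2 (by omega)) ?_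
      have hFj : ∀ i (hi : i = j), (if hi : i ∈ I then (if y i = c ⟨_, hi⟩ then (1 : ℝ) else 0)
          else 1) = 0 := by
        rintro i rfl
        rw [dif_pos hj]
        exact if_neg hjne
      exact hFj _ hj'
  have h1 := hμν (-(M : ℤ)) (2 * M) F
  simp only [hF] at h1
  rw [integral_indicator_one hSm, integral_indicator_one hSm] at h1
  exact (measureReal_eq_measureReal_iff (measure_ne_top _ _) (measure_ne_top _ _)).1 h1.symm

/-- The Ising model on the edges of `ℤ` exists, and expectations of product functions are given
by a Perron eigenvector of the transfer matrix. -/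
theorem exists_isEdgeIsing {J : ℝ} (hJ : 0 < J) (h : ℝ) :
    ∃ (μ : ProbabilityMeasure (ℤ → Bool)) (lam : ℝ) (v : Bool → ℝ),
      IsEdgeIsing J (fun _ => h) μ ∧ 0 < lam ∧ (∀ b, 0 < v b) ∧ transfer J h v = lam • v ∧
      ∀ (k : ℤ) (L : ℕ) (F : ℕ → Bool → ℝ),
        ∫ y, ∏ i ∈ Finset.range (L + 1), F i (y (k + i)) ∂(μ : Measure (ℤ → Bool))
          = (∑ b, v b * chain (transfer J h) F L v b) / (lam ^ L * ∑ b, v b * v b) := by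
  obtain ⟨lam, v, hlam, hv, hKv, hlim⟩ :=
    exists_perron hJ h (w := boundaryWeight h) fun b => Real.exp_pos _
  have hconv := tendsto_integral_isingMeasure hlam hv hKv hlim
  set f : Filter (ProbabilityMeasure (ℤ → Bool)) :=
    map (fun mn : ℤ × ℤ => isingLaw J (fun _ => h) mn.1 mn.2) (atBot ×ˢ atTop) with hf
  have hclust : ∀ μ : ProbabilityMeasure (ℤ → Bool), ClusterPt μ f →
      ∀ (k : ℤ) (L : ℕ) (F : ℕ → Bool → ℝ),
        ∫ y, ∏ i ∈ Finset.range (L + 1), F i (y (k + i)) ∂(μ : Measure (ℤ → Bool))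
          = (∑ b, v b * chain (transfer J h) F L v b) / (lam ^ L * ∑ b, v b * v b) := by
    intro μ hμ k L F
    have hcont : Continuous fun ρ : ProbabilityMeasure (ℤ → Bool) =>
        ∫ y, ∏ i ∈ Finset.range (L + 1), F i (y (k + i)) ∂(ρ : Measure (ℤ → Bool)) :=
      ProbabilityMeasure.continuous_integral_boundedContinuousFunction
        (windowFunction k (L + 1) F)
    -- The integral against a cluster point is a cluster point of a convergent family of reals,
    -- hence its limit.
    have h1 := hμ.map hcont.continuousAt tendsto_map
    have : NeBot (𝓝 (∫ y, ∏ i ∈ Finset.range (L + 1), F i (y (k + i)) ∂(μ : Measure (ℤ → Bool)))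
      ⊓ 𝓝 ((∑ b, v b * chain (transfer J h) F L v b) / (lam ^ L * ∑ b, v b * v b))) := by
      refine NeBot.mono h1 (inf_le_inf_left _ ?_)
      rw [hf, map_map]
      exact hconv k L F
    exact eq_of_nhds_neBot this
  obtain ⟨μ, hμ⟩ := exists_clusterPt_of_compactSpace f
  refine ⟨μ, lam, v, ?_, hlam, hv, hKv, hclust μ hμ⟩
  refine le_nhds_of_unique_clusterPt fun ν hν => ?_
  exact eq_of_forall_integral_prod_eq fun k L F => by rw [hclust μ hμ, hclust ν hν]

end DivideColor

namespace DivideColor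

/-! ### The color process -/

theorem edgeColorLaw_apply (p : unitInterval) (μ : Measure (ℤ → Bool)) {E : Set (ℤ → Bool)}
    (hE : MeasurableSet E) :
    edgeColorLaw p μ E = ∫⁻ y, colorGiven p (edgePartition y) E ∂μ := by
  rw [edgeColorLaw, colorLaw, Measure.bind_apply hE (colorKernel ℤ p).measurable.aemeasurable,
    lintegral_map ((colorKernel ℤ p).measurable_coe hE) measurable_edgePartition]
  rfl

/-- A `1` at `s`, followed by `m` zeros. -/
def oneZeros (s : ℤ) (m : ℕ) : Set (ℤ → Bool) :=
  {x | x s = true ∧ ∀ i < m, x (s + 1 + i) = false}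

theorem measurableSet_oneZeros (s : ℤ) (m : ℕ) : MeasurableSet (oneZeros s m) := by
  have : oneZeros s m = {x | x s = true} ∩ ⋂ i : ℕ, ⋂ _ : i < m, {x | x (s + 1 + i) = false} := by
    ext x
    simp [oneZeros]
  rw [this]
  exact (measurableSet_eq_fun (measurable_pi_apply _) measurable_const).inter
    (MeasurableSet.iInter fun i => MeasurableSet.iInter fun _ =>
      measurableSet_eq_fun (measurable_pi_apply _) measurable_const)

/-- The factors of the conditional probability of `1 0 ⋯ 0` given the edge process. -/
noncomputable def oneZerosFactor (q : ℝ) : ℕ → Bool → ℝ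
  | 0, b => if b then 0 else 1
  | _ + 1, b => if b then 1 else q

theorem edgePartition_succ (y : ℤ → Bool) (i : ℤ) : edgePartition y i (i + 1) ↔ y i = true := by
  constructor
  · intro h
    exact h i (by simp) (by simp)
  · intro h j h1 h2
    rw [show j = i by simp at h1 h2; omega]
    exact h

theorem edgePartition_of_le {y : ℤ → Bool} {i j k : ℤ} (h : edgePartition y i k) (hij : i ≤ j)
    (hjk : j < k) : y j = true :=
  h j (by simp [hij]) (by simp [hjk])

open Classical in
/-- The classes met by `s + 1, …, s + 1 + L`. -/
noncomputable def classesAfter (y : ℤ → Bool) (s : ℤ) (L : ℕ) : Finset (Quotient (edgePartition y)) :=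
  (Finset.range (L + 1)).image fun i : ℕ => Quotient.mk (edgePartition y) (s + 1 + i)

-- Classes are intervals, so a further site opens a new class exactly when the edge just before it
-- carries `-1`.
open Classical in
theorem pow_card_classesAfter (y : ℤ → Bool) (s : ℤ) (L : ℕ) (q : ℝ) :
    q ^ (classesAfter y s L).card
      = q * ∏ i ∈ Finset.range L, (if y (s + 1 + i) then 1 else q) := by
  induction L with
  | zero => simp [classesAfter]
  | succ L ih =>
    have hins : classesAfter y s (L + 1)
        = insert (Quotient.mk (edgePartition y) (s + 1 + (L + 1 : ℕ))) (classesAfter y s L) := by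
      rw [classesAfter, Finset.range_add_one, Finset.image_insert]
      rfl
    have hcast : s + 1 + ((L + 1 : ℕ) : ℤ) = s + 1 + L + 1 := by push_cast; ring
    rw [Finset.prod_range_succ, ← mul_assoc, ← ih, hins]
    by_cases hy : y (s + 1 + L) = true
    · rw [if_pos hy, mul_one, Finset.insert_eq_of_mem]
      refine Finset.mem_image.2 ⟨L, by simp, ?_⟩
      rw [hcast]
      exact Quotient.sound ((edgePartition_succ y _).2 hy)
    · rw [if_neg hy, Finset.card_insert_of_notMem, pow_succ]
      intro hmem
      obtain ⟨i, hi, hiq⟩ := Finset.mem_image.1 hmem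
      have hi' := Finset.mem_range.1 hi
      exact hy (edgePartition_of_le (Quotient.exact hiq) (by omega) (by omega))

/-- The conditional probability of `1 0 ⋯ 0` given the edge process. -/
theorem colorGiven_oneZeros (p : unitInterval) (y : ℤ → Bool) (s : ℤ) (L : ℕ) :
    colorGiven p (edgePartition y) (oneZeros s (L + 1))
      = ENNReal.ofReal (p * (1 - p)
          * ∏ i ∈ Finset.range (L + 1), oneZerosFactor (1 - p) i (y (s + i))) := by
  classical
  have hm : Measurable fun (c : Quotient (edgePartition y) → Bool) (i : ℤ) =>
      c (Quotient.mk (edgePartition y) i) :=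
    measurable_pi_lambda _ fun i => measurable_pi_apply _
  have hfac : ∏ i ∈ Finset.range (L + 1), oneZerosFactor (1 - p) i (y (s + i))
      = (∏ i ∈ Finset.range L, (if y (s + 1 + i) then 1 else 1 - (p : ℝ)))
        * (if y s then 0 else 1) := by
    rw [Finset.prod_range_succ']
    simp only [oneZerosFactor, Nat.cast_add, Nat.cast_one, Nat.cast_zero, add_zero, add_assoc,
      add_comm (1 : ℤ)]
  rw [colorGiven, Measure.map_apply hm (measurableSet_oneZeros _ _), hfac]
  by_cases hy : y s = true
  -- Here `s` and `s + 1` share a class, so they cannot have different colors.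
  · rw [if_pos hy, mul_zero, mul_zero, ENNReal.ofReal_zero]
    refine (congrArg _ ?_).trans (measure_empty (μ := Measure.infinitePi fun _ :
      Quotient (edgePartition y) => bernoulliMeasure true false p))
    refine Set.eq_empty_of_forall_notMem fun c hc => ?_
    obtain ⟨h1, h2⟩ := hc
    have h3 := h2 0 (by omega)
    have h4 : Quotient.mk (edgePartition y) s = Quotient.mk (edgePartition y) (s + 1) :=
      Quotient.sound ((edgePartition_succ y s).2 hy)
    simp only [Nat.cast_zero, add_zero, ← h4, h1] at h3
    exact absurd h3 (by simp)
  -- The class of `s` ends at `s`, so its color is independent of those of all later classes.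
  · have hs : Quotient.mk (edgePartition y) s ∉ classesAfter y s L := by
      intro hmem
      obtain ⟨i, hi, hiq⟩ := Finset.mem_image.1 hmem
      exact hy (edgePartition_of_le ((edgePartition y).symm (Quotient.exact hiq)) le_rfl
        (by omega))
    let t : Quotient (edgePartition y) → Set Bool := fun c =>
      if c = Quotient.mk (edgePartition y) s then {true} else {false}
    have hpre : (fun (c : Quotient (edgePartition y) → Bool) (i : ℤ) =>
        c (Quotient.mk (edgePartition y) i)) ⁻¹' oneZeros s (L + 1)
        = Set.pi (insert (Quotient.mk (edgePartition y) s) (classesAfter y s L) :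
          Finset (Quotient (edgePartition y))) t := by
      ext c
      rw [Finset.coe_insert, Set.insert_pi]
      refine and_congr ?_ ?_
      · simp [t]
      · have ht : ∀ d ∈ classesAfter y s L, t d = {false} := by
          intro d hd
          exact if_neg (ne_of_mem_of_not_mem hd hs)
        constructor
        · intro hc d hd
          rw [ht d hd]
          obtain ⟨i, hi, rfl⟩ := Finset.mem_image.1 (Finset.mem_coe.1 hd)
          exact hc i (Finset.mem_range.1 hi)
        · intro hc i hi
          have hd : Quotient.mk (edgePartition y) (s + 1 + i) ∈ classesAfter y s L :=
            Finset.mem_image_of_mem _ (Finset.mem_range.2 hi)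
          have := hc _ hd
          rwa [ht _ hd] at this
    have hp1 : bernoulliMeasure true false p {true} = ENNReal.ofReal p := by
      rw [← ofReal_measureReal, bernoulliMeasure_real_apply_of_mem_of_notMem p (by simp) (by simp) (by simp)]
    have hp0 : bernoulliMeasure true false p {false} = ENNReal.ofReal (1 - p) := by
      rw [← ofReal_measureReal, bernoulliMeasure_real_apply_of_notMem_of_mem p (by simp) (by simp) (by simp)]
    have hq0 : (0 : ℝ) ≤ 1 - p := sub_nonneg.2 p.2.2
    rw [hpre, Measure.infinitePi_pi _ (fun _ _ => MeasurableSet.of_discrete),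
      Finset.prod_insert hs, Finset.prod_congr rfl (g := fun _ => ENNReal.ofReal (1 - p)),
      Finset.prod_const, if_neg hy, mul_one, mul_assoc, ← pow_card_classesAfter,
      ENNReal.ofReal_mul p.2.1, ENNReal.ofReal_pow hq0]
    · simp only [t, if_true, hp1]
    · intro d hd
      have : t d = {false} := if_neg (ne_of_mem_of_not_mem hd hs)
      rw [this, hp0]

/-- The probability of `1 0 ⋯ 0` in the color process. -/
theorem edgeColorLaw_oneZeros (p : unitInterval) (μ : ProbabilityMeasure (ℤ → Bool)) (s : ℤ)
    (L : ℕ) :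
    edgeColorLaw p (μ : Measure (ℤ → Bool)) (oneZeros s (L + 1))
      = ENNReal.ofReal (p * (1 - p) * ∫ y, ∏ i ∈ Finset.range (L + 1),
          oneZerosFactor (1 - p) i (y (s + i)) ∂(μ : Measure (ℤ → Bool))) := by
  have hq0 : (0 : ℝ) ≤ 1 - p := sub_nonneg.2 p.2.2
  rw [edgeColorLaw_apply p _ (measurableSet_oneZeros _ _), ← integral_const_mul,
    ofReal_integral_eq_lintegral_ofReal]
  · simp only [colorGiven_oneZeros]
  · exact ((windowFunction s (L + 1) (oneZerosFactor (1 - p))).integrable _).const_mul _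
  · refine ae_of_all _ fun y => mul_nonneg (mul_nonneg p.2.1 hq0)
      (Finset.prod_nonneg fun i _ => ?_)
    cases i <;> simp only [oneZerosFactor] <;> split_ifs <;> simp [hq0]

/-- With a deterministic coloring, the color process is constant. -/
theorem edgeColorLaw_of_dirac {p : unitInterval} {b : Bool}
    (hp : bernoulliMeasure true false p = Measure.dirac b) (μ : Measure (ℤ → Bool))
    [IsProbabilityMeasure μ] : edgeColorLaw p μ = Measure.dirac fun _ => b := by
  refine Measure.ext fun E hE => ?_
  have : ∀ y, colorGiven p (edgePartition y) E = Measure.dirac (fun _ : ℤ => b) E := by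
    intro y
    have hm : Measurable fun (c : Quotient (edgePartition y) → Bool) (i : ℤ) =>
        c (Quotient.mk (edgePartition y) i) :=
      measurable_pi_lambda _ fun i => measurable_pi_apply _
    rw [colorGiven]
    simp only [hp]
    rw [Measure.infinitePi_dirac, Measure.map_dirac' hm]
  rw [edgeColorLaw_apply p μ hE]
  simp only [this, lintegral_const, measure_univ, mul_one]

/-! ### Consequences and instances of the step Markov property -/

theorem measurableSet_pastEvent (a : ℤ → Bool) (k : ℤ) (m : ℕ) :
    MeasurableSet (pastEvent a k m) := by
  have : pastEvent a k m = ⋂ j : ℤ, ⋂ _ : k - m ≤ j, ⋂ _ : j < k, {x | x j = a j} := by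
    ext x
    simp [pastEvent]
  rw [this]
  exact MeasurableSet.iInter fun j => MeasurableSet.iInter fun _ => MeasurableSet.iInter fun _ =>
    measurableSet_eq_fun (measurable_pi_apply _) measurable_const

theorem isStepMarkov_dirac (n : ℕ) (x : ℤ → Bool) : IsStepMarkov n (Measure.dirac x) := by
  intro k m hnm a ha
  have hx : x ∈ pastEvent a k m := by
    by_contra hx
    exact ha (by rw [Measure.dirac_apply' _ (measurableSet_pastEvent a k m),
      Set.indicator_of_notMem hx])
  have hx' : x ∈ pastEvent a k n := fun j h1 h2 => hx j (by omega) h2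
  rw [cond_apply (measurableSet_pastEvent a k m), cond_apply (measurableSet_pastEvent a k n)]
  simp [hx, hx', Set.indicator]

/-- In an `n`-step Markov process, the probabilities of `1 0 ⋯ 0` followed by one more zero are
eventually a constant multiple of those of `1 0 ⋯ 0`. -/
theorem IsStepMarkov.exists_oneZeros_eq {n : ℕ} {P : Measure (ℤ → Bool)} [IsFiniteMeasure P]
    (hP : IsStepMarkov n P) :
    ∃ c : ENNReal, ∀ m : ℕ, n ≤ m → P (oneZeros (-(m + 1 : ℕ)) m) ≠ 0 →
      P (oneZeros (-(m + 1 : ℕ)) (m + 1)) = c * P (oneZeros (-(m + 1 : ℕ)) m) := by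
  refine ⟨cond P (pastEvent (fun _ => false) 0 n) {x | x 0 = false}, fun m hnm hne => ?_⟩
  -- A past of length `m + 1`: a single `1`, then `m ≥ n` zeros. Its last `n` values are all zero,
  -- so the short conditioning does not depend on `m`.
  set a : ℤ → Bool := fun j => decide (j = -(m + 1 : ℕ)) with ha
  have hpast : pastEvent a 0 (m + 1) = oneZeros (-(m + 1 : ℕ)) m := by
    ext x
    constructor
    · intro hx
      refine ⟨(hx _ (by omega) (by omega)).trans (by simp [ha]), fun i hi => ?_⟩
      refine (hx _ (by omega) (by omega)).trans ?_
      simp only [ha, decide_eq_false_iff_not]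
      omega
    · rintro ⟨h1, h2⟩ j hj1 hj2
      by_cases hj : j = -(m + 1 : ℕ)
      · rw [hj, h1]; simp [ha]
      · have h3 := h2 (j + m).toNat (by omega)
        rw [show -((m + 1 : ℕ) : ℤ) + 1 + ((j + m).toNat : ℤ) = j by omega] at h3
        rw [h3]
        exact (decide_eq_false hj).symm
  have hpast' : pastEvent a 0 n = pastEvent (fun _ => false) 0 n := by
    ext x
    refine forall_congr' fun j => forall_congr' fun h1 => forall_congr' fun h2 => ?_
    have : a j = false := by
      simp only [ha, decide_eq_false_iff_not]
      omega
    rw [this]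
  have ha0 : a 0 = false := by
    simp only [ha, decide_eq_false_iff_not]
    omega
  have h1 := hP 0 (m + 1) (by omega) a (by rwa [hpast])
  rw [hpast', hpast, ha0] at h1
  rw [← h1, mul_comm, mul_comm, cond_mul_eq_inter (measurableSet_oneZeros _ _)]
  congr 1
  ext x
  constructor
  · rintro ⟨h2, h3⟩
    refine ⟨⟨h2, fun i hi => h3 i (by omega)⟩, ?_⟩
    have := h3 m (by omega)
    rwa [show -((m + 1 : ℕ) : ℤ) + 1 + (m : ℤ) = 0 by omega] at this
  · rintro ⟨⟨h2, h3⟩, h4⟩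
    refine ⟨h2, fun i hi => ?_⟩
    rcases Nat.lt_succ_iff_lt_or_eq.1 hi with h5 | rfl
    · exact h3 i h5
    · rw [show -((i + 1 : ℕ) : ℤ) + 1 + (i : ℤ) = 0 by omega]
      exact h4

end DivideColor

/-! ### Characterization of the parameters with the Markov property -/

namespace DivideColor

instance (p : unitInterval) (μ : Measure (ℤ → Bool)) [IsProbabilityMeasure μ] :
    IsProbabilityMeasure (edgeColorLaw p μ) := by
  constructor
  rw [edgeColorLaw_apply p μ MeasurableSet.univ]
  simp

end DivideColor

theorem theorem4p6 (J : ℝ) (hJ : 0 < J) (h : ℝ) :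
    ∃ μ : ProbabilityMeasure (ℤ → Bool),
      DivideColor.IsEdgeIsing J (fun _ => h) μ ∧
      ∀ (p : unitInterval) (n : ℕ), 1 ≤ n →
        (DivideColor.IsStepMarkov n (DivideColor.edgeColorLaw p (μ : Measure (ℤ → Bool)))
          ↔ p = 0 ∨ p = 1) := by
  open DivideColor in
  obtain ⟨μ, lam, v, hμ, hlam, hv, hKv, hint⟩ := exists_isEdgeIsing hJ h
  refine ⟨μ, hμ, fun p n _ => ⟨fun hM => ?_, ?_⟩⟩
  · by_contra! hp
    have hp0 : (0 : ℝ) < p := unitInterval.pos_iff_ne_zero.2 hp.1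
    have hp1 : (p : ℝ) < 1 := unitInterval.lt_one_iff_ne_one.2 hp.2
    have hq : 0 < 1 - (p : ℝ) := sub_pos.2 hp1
    set B : Module.End ℝ (Bool → ℝ) :=
      transfer J h * LinearMap.mulLeft ℝ (fun b : Bool => if b then 1 else 1 - (p : ℝ)) with hB
    have hvv : 0 < ∑ b, v b * v b :=
      Finset.sum_pos (fun b _ => mul_pos (hv b) (hv b)) Finset.univ_nonempty
    -- The first factor kills the value `true` of edge `s`, so only `v false` survives from the left
    -- eigenvector.
    set C : ℝ := p * (1 - p) * v false / ∑ b, v b * v b with hC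
    have hC0 : 0 < C := div_pos (mul_pos (mul_pos hp0 hq) (hv _)) hvv
    have hval : ∀ (s : ℤ) (L : ℕ), edgeColorLaw p (μ : Measure (ℤ → Bool)) (oneZeros s (L + 1))
        = ENNReal.ofReal (C * ((B ^ L) v false / lam ^ L)) := by
      intro s L
      rw [edgeColorLaw_oneZeros, hint, chain_of_forall_succ _
        (D := fun b : Bool => if b then 1 else 1 - (p : ℝ)) fun _ => rfl]
      congr 1
      simp only [Fintype.sum_bool, Pi.mul_apply, oneZerosFactor, if_true, Bool.false_eq_true,
        if_false, zero_mul, mul_zero, zero_add, one_mul, hC, ← hB] at hvv ⊢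
      have := pow_pos hlam L
      field_simp
    have hBpos : ∀ (L : ℕ) (b : Bool), 0 < (B ^ L) v b := by
      intro L
      induction L with
      | zero => simpa using hv
      | succ L ih =>
        intro b
        rw [pow_succ', Module.End.mul_apply, hB, Module.End.mul_apply, transfer_apply]
        refine Finset.sum_pos (fun c _ => mul_pos (transferWeight_pos J h b c) ?_)
          Finset.univ_nonempty
        refine mul_pos ?_ (ih c)
        cases c <;> simp [hq]
    obtain ⟨c, hc⟩ := hM.exists_oneZeros_eq
    -- The factor `lam` compensates for the normalization `lam ^ L` of the probabilities.
    refine not_eventually_geometric hJ h hq (by linarith) hv hKv n (c.toReal * lam) fun L hL => ?_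
    have hpos : 0 < C * ((B ^ L) v false / lam ^ L) :=
      mul_pos hC0 (div_pos (hBpos L false) (pow_pos hlam L))
    have hpos' : 0 < C * ((B ^ (L + 1)) v false / lam ^ (L + 1)) :=
      mul_pos hC0 (div_pos (hBpos (L + 1) false) (pow_pos hlam (L + 1)))
    have h1 := hc (L + 1) (by omega) (by rw [hval]; exact (ENNReal.ofReal_pos.2 hpos).ne')
    rw [hval, hval] at h1
    have h2 := congrArg ENNReal.toReal h1
    rw [ENNReal.toReal_mul, ENNReal.toReal_ofReal hpos.le, ENNReal.toReal_ofReal hpos'.le] at h2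
    have hl := pow_pos hlam L
    rw [pow_succ lam] at h2
    field_simp at h2
    rw [← hB]
    linarith
  · rintro (rfl | rfl)
    · rw [edgeColorLaw_of_dirac (bernoulliMeasure_zero true false)]
      exact isStepMarkov_dirac n _
    · rw [edgeColorLaw_of_dirac (bernoulliMeasure_one true false)]
      exact isStepMarkov_dirac n _
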